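/- Consider fillings of a rectangular grid, with rows numbered from top to bottom and columns from left to right, in which each cell is either dotted or not. A complete non-ambiguous tree (CNAT) is such a filling satisfying: (1) every row and every column contains a dotted cell; (2) every dotted cell other than the top-left cell has either a dotted cell above it in the same column or a dotted cell to its left in the same row, but not both; (3) every dotted cell has either both a dotted cell below it in the same column and a dotted cell to its right in the same row, or neither of these. In the latter case the dotted cell is called a leaf dot. A permutation $\pi=\pi_1\cdots\pi_n$ of $\{1,\dots,n\}$ is associated with a CNAT on an $n\times n$ grid if the leaf dots of the CNAT are exactly the cells in column $i$ and row $\pi_i$, for $i=1,\dots,n$. Let $\mathrm{cnat}(\pi)$ be the number of CNATs with which $\pi$ is associated, let $S_n$ be the set of all permutations of $\{1,\dots,n\}$, and let $B(n,k)=\{\pi\in S_n : \mathrm{cnat}(\pi)=k\}$. Theorem. For every $n\ge 1$, $\max\{\mathrm{cnat}(\pi) : \pi\in S_n\}=(n-1)!$, and this maximum is attained only by the decreasing permutation $\mathrm{dec}_n=n(n-1)\cdots 1$. In other words, $B(n,(n-1)!)=\{\mathrm{dec}_n\}$, and $B(n,k)=\emptyset$ for every $k>(n-1)!$. -/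

import Mathlib

open scoped Nat

/-! Cells of an `m × n` grid (`m` rows, `n` columns) are pairs `(c, r) : Fin n × Fin m`, where `c` is
the column (numbered from left to right) and `r` the row (numbered from top to bottom). A filling of the
grid is identified with its set of dotted cells. -/

/-- The filling `T` has a dotted cell strictly above the cell `p`, in the same column. -/
def HasDotAbove {m n : ℕ} (T : Set (Fin n × Fin m)) (p : Fin n × Fin m) : Prop :=
  ∃ r : Fin m, r < p.2 ∧ (p.1, r) ∈ T

/-- The filling `T` has a dotted cell strictly to the left of the cell `p`, in the same row. -/
def HasDotLeft {m n : ℕ} (T : Set (Fin n × Fin m)) (p : Fin n × Fin m) : Prop :=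
  ∃ c : Fin n, c < p.1 ∧ (c, p.2) ∈ T

/-- The filling `T` has a dotted cell strictly below the cell `p`, in the same column. -/
def HasDotBelow {m n : ℕ} (T : Set (Fin n × Fin m)) (p : Fin n × Fin m) : Prop :=
  ∃ r : Fin m, p.2 < r ∧ (p.1, r) ∈ T

/-- The filling `T` has a dotted cell strictly to the right of the cell `p`, in the same row. -/
def HasDotRight {m n : ℕ} (T : Set (Fin n × Fin m)) (p : Fin n × Fin m) : Prop :=
  ∃ c : Fin n, p.1 < c ∧ (c, p.2) ∈ T

/-- A non-ambiguous tree. -/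
structure IsNAT {m n : ℕ} (T : Set (Fin n × Fin m)) : Prop where
  row_nonempty : ∀ r : Fin m, ∃ c : Fin n, (c, r) ∈ T
  col_nonempty : ∀ c : Fin n, ∃ r : Fin m, (c, r) ∈ T
  /-- Every dotted cell other than the top-left cell has exactly one of: a dot above it in its
  column, a dot to its left in its row. -/
  unique_parent : ∀ p ∈ T, ¬ ((p.1 : ℕ) = 0 ∧ (p.2 : ℕ) = 0) →
    Xor (HasDotAbove T p) (HasDotLeft T p)

/-- A complete non-ambiguous tree: every dot has both a dot below it and a dot to its right,
or neither. -/
structure IsCNAT {m n : ℕ} (T : Set (Fin n × Fin m)) : Prop extends IsNAT T where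
  complete : ∀ p ∈ T, (HasDotBelow T p ∧ HasDotRight T p) ∨
    (¬ HasDotBelow T p ∧ ¬ HasDotRight T p)

/-- The leaf dots: no dot below in the same column, no dot to the right in the same row. -/
def leafDots {m n : ℕ} (T : Set (Fin n × Fin m)) : Set (Fin n × Fin m) :=
  {p | p ∈ T ∧ ¬ HasDotBelow T p ∧ ¬ HasDotRight T p}

/-- The graphical representation of a permutation: in column `i` there is one dot, in row `π i`. -/
def graphicalRep {n : ℕ} (π : Equiv.Perm (Fin n)) : Set (Fin n × Fin n) :=
  {p | p.2 = π p.1}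

/-- The set of CNATs whose associated permutation is `π`, that is, whose leaf dots form the
graphical representation of `π`. -/
def CNATs {n : ℕ} (π : Equiv.Perm (Fin n)) : Set (Set (Fin n × Fin n)) :=
  {T | IsCNAT T ∧ leafDots T = graphicalRep π}

/-- The number of CNATs whose associated permutation is `π`. -/
noncomputable def cnat {n : ℕ} (π : Equiv.Perm (Fin n)) : ℕ :=
  (CNATs π).ncard

/-- The set of `n`-permutations associated with exactly `k` CNATs. -/
def permsWithCNATs (n k : ℕ) : Set (Equiv.Perm (Fin n)) :=
  {π | cnat π = k}

/-- The decreasing permutation `n (n-1) ⋯ 1` (on `{0, …, n-1}`, it maps `i` to `n - 1 - i`). -/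
def decPerm (n : ℕ) : Equiv.Perm (Fin n) :=
  Fin.revPerm

/-! Let `a` and `b = a + 1` be adjacent columns. Interchanging them below their common rows is a
bijection between the trees for `π` without a dot at `(a, π b)` and the trees for `π * swap a b`
without a dot at `(a, π a)`. At an ascent `π a < π b` the first restriction is vacuous, since `(a, π
b)` lies below a leaf. Creating an inversion therefore adds exactly the trees with a dot at its
corner (`cnat_mul_swap`).

Every permutation other than the decreasing one has an ascent, so such swaps lead to `decPerm`,
never lowering the count. The last swap is strict, because every adjacent corner occurs in some tree
for `decPerm`. This gives the unique maximum.

For its value, slide the largest entry leftwards through `decPerm m`. At the right end there are no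
trees (for `m ≥ 1`). Each slide adds the trees with a dot at one corner; contracting the two leaves
at that corner identifies them with the trees for `decPerm m`. After `m` slides the count is `m *
cnat (decPerm m)`, whence the factorial. -/

/-! ### Cellwise description of the trees -/

/-- Completeness disappears: once the leaves bound every row and column, a dot that is not a leaf
has the leaf of its column below it and the leaf of its row to its right. -/
theorem mem_CNATs_iff {n : ℕ} {π : Equiv.Perm (Fin n)} {T : Set (Fin n × Fin n)} :
    T ∈ CNATs π ↔
      (∀ c, (c, π c) ∈ T) ∧
      (∀ c r, (c, r) ∈ T → r ≤ π c) ∧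
      (∀ c d, (c, π d) ∈ T → c ≤ d) ∧
      (∀ c r, (c, r) ∈ T → ∀ d < c, (d, r) ∈ T → ∀ s < r, (c, s) ∉ T) ∧
      (∀ c r, (c, r) ∈ T → ((c : ℕ) = 0 ∧ (r : ℕ) = 0) ∨
        (∃ s < r, (c, s) ∈ T) ∨ (∃ d < c, (d, r) ∈ T)) := by
  constructor
  · rintro ⟨hT, hL⟩
    have hleaf : ∀ c, (c, π c) ∈ leafDots T := fun c => by rw [hL]; rfl
    refine ⟨fun c => (hleaf c).1, fun c r h => ?_, fun c d h => ?_, ?_, ?_⟩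
    · by_contra! hlt
      exact (hleaf c).2.1 ⟨r, hlt, h⟩
    · by_contra! hlt
      exact (hleaf d).2.2 ⟨c, hlt, h⟩
    · intro c r h d hd hdr s hs hcs
      by_cases h0 : ((c : ℕ) = 0 ∧ (r : ℕ) = 0)
      · have : (d : ℕ) < c := hd
        omega
      · rcases hT.unique_parent _ h h0 with ⟨_, h2⟩ | ⟨_, h2⟩
        · exact h2 ⟨d, hd, hdr⟩
        · exact h2 ⟨s, hs, hcs⟩
    · intro c r h
      by_cases h0 : ((c : ℕ) = 0 ∧ (r : ℕ) = 0)
      · exact Or.inl h0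
      · exact Or.inr ((hT.unique_parent _ h h0).imp (fun h => h.1) (fun h => h.1))
  · rintro ⟨ha, hb, hb', hc, hd⟩
    have hright : ∀ c r, (c, r) ∈ T → c ≤ π.symm r := fun c r h =>
      hb' c (π.symm r) (by simpa using h)
    have hrow : ∀ r, (π.symm r, r) ∈ T := fun r => by simpa using ha (π.symm r)
    have hcell : ∀ c r, (c, r) ∈ T →
        (r = π c ∧ ¬ HasDotBelow T (c, r) ∧ ¬ HasDotRight T (c, r)) ∨
        (r ≠ π c ∧ HasDotBelow T (c, r) ∧ HasDotRight T (c, r)) := by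
      intro c r h
      by_cases hr : r = π c
      · subst hr
        refine Or.inl ⟨rfl, ?_, ?_⟩
        · rintro ⟨s, hs, hcs⟩
          exact absurd (hb _ _ hcs) (not_le.2 hs)
        · rintro ⟨s, hs, hcs⟩
          exact absurd (hb' _ _ hcs) (not_le.2 hs)
      · refine Or.inr ⟨hr, ⟨π c, lt_of_le_of_ne (hb _ _ h) hr, ha c⟩,
          ⟨π.symm r, lt_of_le_of_ne (hright _ _ h) ?_, hrow r⟩⟩
        rintro rfl
        simp at hr
    refine ⟨⟨⟨fun r => ⟨_, hrow r⟩, fun c => ⟨_, ha c⟩, ?_⟩, ?_⟩, ?_⟩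
    · rintro ⟨c, r⟩ h h0
      rcases (hd c r h).resolve_left h0 with ⟨s, hs, hcs⟩ | ⟨d, hd, hdr⟩
      · exact Or.inl ⟨⟨s, hs, hcs⟩, fun ⟨d, hd, hdr⟩ => hc c r h d hd hdr s hs hcs⟩
      · exact Or.inr ⟨⟨d, hd, hdr⟩, fun ⟨s, hs, hcs⟩ => hc c r h d hd hdr s hs hcs⟩
    · rintro ⟨c, r⟩ h
      have := hcell c r h
      tauto
    · ext ⟨c, r⟩
      constructor
      · rintro ⟨h, h1, h2⟩
        exact ((hcell c r h).resolve_right fun h3 => h1 h3.2.1).1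
      · intro h
        obtain rfl : r = π c := h
        exact ⟨ha c, ((hcell c _ (ha c)).resolve_right fun h3 => h3.1 rfl).2⟩

/-! ### Interchanging adjacent columns -/

/-- Interchange the columns `a` and `b` strictly below the rows in which both are dotted. -/
def columnSwap {n : ℕ} (a b : Fin n) (T : Set (Fin n × Fin n)) : Set (Fin n × Fin n) :=
  {p | ((∃ r, (a, r) ∈ T ∧ (b, r) ∈ T ∧ p.2 ≤ r) ∧ p ∈ T) ∨
    ((∀ r, (a, r) ∈ T → (b, r) ∈ T → r < p.2) ∧ (Equiv.swap a b p.1, p.2) ∈ T)}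

theorem mem_columnSwap_of_le {n : ℕ} {a b : Fin n} {T : Set (Fin n × Fin n)} {c y r : Fin n}
    (ha : (a, r) ∈ T) (hb : (b, r) ∈ T) (h : y ≤ r) :
    (c, y) ∈ columnSwap a b T ↔ (c, y) ∈ T := by
  constructor
  · rintro (h1 | h1)
    · exact h1.2
    · exact absurd (h1.1 r ha hb) (not_lt.2 h)
  · exact fun h1 => Or.inl ⟨⟨r, ha, hb, h⟩, h1⟩

theorem mem_columnSwap_of_forall_lt {n : ℕ} {a b : Fin n} {T : Set (Fin n × Fin n)} {c y : Fin n}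
    (h : ∀ r, (a, r) ∈ T → (b, r) ∈ T → r < y) :
    (c, y) ∈ columnSwap a b T ↔ (Equiv.swap a b c, y) ∈ T := by
  constructor
  · rintro (⟨⟨r, h1, h2, h3⟩, _⟩ | h1)
    · exact absurd (h r h1 h2) (not_lt.2 h3)
    · exact h1.2
  · exact fun h1 => Or.inr ⟨h, h1⟩

theorem mem_columnSwap_of_ne {n : ℕ} {a b : Fin n} {T : Set (Fin n × Fin n)} {c y : Fin n}
    (ha : c ≠ a) (hb : c ≠ b) : (c, y) ∈ columnSwap a b T ↔ (c, y) ∈ T := by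
  by_cases h : ∃ r, (a, r) ∈ T ∧ (b, r) ∈ T ∧ y ≤ r
  · obtain ⟨r, h1, h2, h3⟩ := h
    exact mem_columnSwap_of_le h1 h2 h3
  · push Not at h
    rw [mem_columnSwap_of_forall_lt h, Equiv.swap_apply_of_ne_of_ne ha hb]

/-- The common rows, which determine where the interchange starts, are preserved; hence `columnSwap`
is an involution. -/
theorem columnSwap_common {n : ℕ} {a b : Fin n} {T : Set (Fin n × Fin n)} {r : Fin n} :
    ((a, r) ∈ columnSwap a b T ∧ (b, r) ∈ columnSwap a b T) ↔ ((a, r) ∈ T ∧ (b, r) ∈ T) := by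
  by_cases h : ∃ s, (a, s) ∈ T ∧ (b, s) ∈ T ∧ r ≤ s
  · obtain ⟨s, h1, h2, h3⟩ := h
    rw [mem_columnSwap_of_le h1 h2 h3, mem_columnSwap_of_le h1 h2 h3]
  · push Not at h
    rw [mem_columnSwap_of_forall_lt h, mem_columnSwap_of_forall_lt h, Equiv.swap_apply_left,
      Equiv.swap_apply_right, and_comm]

theorem columnSwap_columnSwap {n : ℕ} (a b : Fin n) (T : Set (Fin n × Fin n)) :
    columnSwap a b (columnSwap a b T) = T := by
  ext ⟨c, y⟩
  by_cases h : ∃ r, (a, r) ∈ T ∧ (b, r) ∈ T ∧ y ≤ r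
  · obtain ⟨r, h1, h2, h3⟩ := h
    obtain ⟨h1', h2'⟩ := columnSwap_common.2 ⟨h1, h2⟩
    rw [mem_columnSwap_of_le h1' h2' h3, mem_columnSwap_of_le h1 h2 h3]
  · push Not at h
    rw [mem_columnSwap_of_forall_lt, mem_columnSwap_of_forall_lt h, Equiv.swap_apply_self]
    intro r h1 h2
    obtain ⟨h1', h2'⟩ := columnSwap_common.1 ⟨h1, h2⟩
    exact h r h1' h2'

/-- Nothing moves down to the lowest common row, and that row, if it exists, supplies a dot above
every dot moved below it. Further down no row meets both columns, so neither provides left parents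
for the other. By adjacency, every other column has `a` and `b` on the same side. -/
theorem columnSwap_mem_CNATs {n : ℕ} {π : Equiv.Perm (Fin n)} {T : Set (Fin n × Fin n)}
    {a b : Fin n} (hab : (b : ℕ) = a + 1) (hT : T ∈ CNATs π) (h : (a, π b) ∉ T) :
    columnSwap a b T ∈ CNATs (π * Equiv.swap a b) ∧ (a, π a) ∉ columnSwap a b T := by
  obtain ⟨ha, hb, hb', hc, hd⟩ := mem_CNATs_iff.1 hT
  have hlt : a < b := by rw [Fin.lt_def]; omega
  have hoth : ∀ c, c ≠ a → c ≠ b → ((c < a ↔ c < b) ∧ (a < c ↔ b < c)) := by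
    intro c h1 h2
    rw [Fin.lt_def, Fin.lt_def, Fin.lt_def, Fin.lt_def]
    rw [Ne, Fin.ext_iff] at h1 h2
    omega
  -- Both leaves lie below all common rows, so they are interchanged. For column `b` this is where
  -- `(a, π b) ∉ T` is needed.
  have hra : ∀ r, (a, r) ∈ T → (b, r) ∈ T → r < π a := fun r h1 h2 =>
    lt_of_le_of_ne (hb _ _ h1) (by rintro rfl; exact absurd (hb' _ _ h2) (not_le.2 hlt))
  have hrb : ∀ r, (a, r) ∈ T → (b, r) ∈ T → r < π b := fun r h1 h2 =>
    lt_of_le_of_ne (hb _ _ h2) (by rintro rfl; exact h h1)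
  have hA : ∀ y, (∀ r, (a, r) ∈ T → (b, r) ∈ T → r < y) →
      ((a, y) ∈ columnSwap a b T ↔ (b, y) ∈ T) := fun y hy => by
    rw [mem_columnSwap_of_forall_lt hy, Equiv.swap_apply_left]
  have hB : ∀ y, (∀ r, (a, r) ∈ T → (b, r) ∈ T → r < y) →
      ((b, y) ∈ columnSwap a b T ↔ (a, y) ∈ T) := fun y hy => by
    rw [mem_columnSwap_of_forall_lt hy, Equiv.swap_apply_right]
  have hK : ∀ c y r, (a, r) ∈ T → (b, r) ∈ T → y ≤ r →
      ((c, y) ∈ columnSwap a b T ↔ (c, y) ∈ T) := fun c y r h1 h2 h3 => mem_columnSwap_of_le h1 h2 h3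
  have hO : ∀ c y, c ≠ a → c ≠ b → ((c, y) ∈ columnSwap a b T ↔ (c, y) ∈ T) := fun c y h1 h2 =>
    mem_columnSwap_of_ne h1 h2
  have hdich : ∀ y, (∀ r, (a, r) ∈ T → (b, r) ∈ T → r < y) ∨
      (∃ r, (a, r) ∈ T ∧ (b, r) ∈ T ∧ y ≤ r) := fun y => by
    by_cases h : ∃ r, (a, r) ∈ T ∧ (b, r) ∈ T ∧ y ≤ r
    · exact Or.inr h
    · push Not at h; exact Or.inl h
  -- The topmost dot of column 1 needs a left parent, which is in column 0. So a common row exists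
  -- and the top-left cell is never moved.
  have hzero : (a : ℕ) = 0 → ∃ r, (a, r) ∈ T ∧ (b, r) ∈ T := by
    intro h0
    obtain ⟨r, hr, hmin⟩ := WellFounded.has_min (wellFounded_lt (α := Fin n))
      {r | (b, r) ∈ T} ⟨π b, ha b⟩
    rcases hd b r hr with h1 | ⟨s, hs, h1⟩ | ⟨d, hd, h1⟩
    · omega
    · exact absurd hs (hmin s h1)
    · have : d = a := by rw [Fin.ext_iff]; rw [Fin.lt_def] at hd; omega
      exact ⟨r, this ▸ h1, hr⟩
  have hCa : ∀ y, (∀ r, (a, r) ∈ T → (b, r) ∈ T → r < y) ∧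
        ((a, y) ∈ columnSwap a b T ↔ (b, y) ∈ T) ∧ ((b, y) ∈ columnSwap a b T ↔ (a, y) ∈ T) ∨
      ∃ r, (a, r) ∈ T ∧ (b, r) ∈ T ∧ y ≤ r ∧ ∀ s ≤ y, ∀ c,
        ((c, s) ∈ columnSwap a b T ↔ (c, s) ∈ T) := fun y => by
    rcases hdich y with h1 | ⟨r, h1, h2, h3⟩
    · exact Or.inl ⟨h1, hA y h1, hB y h1⟩
    · exact Or.inr ⟨r, h1, h2, h3, fun s hs c => hK c s r h1 h2 (hs.trans h3)⟩
  have hoff : ∀ c, c ≠ a → c ≠ b → ∀ y, (c, y) ∈ columnSwap a b T → (c, y) ∈ T :=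
    fun c h1 h2 y h3 => (hO c y h1 h2).1 h3
  have hne : ∀ c, c < a → c ≠ a ∧ c ≠ b := fun c h1 => ⟨h1.ne, (h1.trans hlt).ne⟩
  have hlt_b : ∀ c, c < b → c = a ∨ c < a := fun c h1 => by
    rw [Fin.lt_def] at h1
    rw [Fin.ext_iff, Fin.lt_def]
    omega
  refine ⟨mem_CNATs_iff.2 ⟨?_, ?_, ?_, ?_, ?_⟩, ?_⟩
  · intro c
    rw [Equiv.Perm.mul_apply]
    by_cases h1 : c = a
    · subst h1; rw [Equiv.swap_apply_left, hA _ hrb]; exact ha b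
    by_cases h2 : c = b
    · subst h2; rw [Equiv.swap_apply_right, hB _ hra]; exact ha a
    rw [Equiv.swap_apply_of_ne_of_ne h1 h2, hO _ _ h1 h2]; exact ha c
  · intro c r hcr
    rw [Equiv.Perm.mul_apply]
    by_cases h1 : c = a
    · subst h1
      rw [Equiv.swap_apply_left]
      rcases hCa r with ⟨-, h1, -⟩ | ⟨s, h1, h2, h3, h4⟩
      · exact hb _ _ (h1.1 hcr)
      · exact h3.trans (hb _ _ h2)
    by_cases h2 : c = b
    · subst h2
      rw [Equiv.swap_apply_right]
      rcases hCa r with ⟨-, -, h1⟩ | ⟨s, h1, h2, h3, h4⟩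
      · exact hb _ _ (h1.1 hcr)
      · exact h3.trans (hb _ _ h1)
    rw [Equiv.swap_apply_of_ne_of_ne h1 h2]
    exact hb _ _ (hoff c h1 h2 _ hcr)
  · intro c d hcd
    rw [Equiv.Perm.mul_apply] at hcd
    by_cases h1 : d = a
    · subst h1
      rw [Equiv.swap_apply_left] at hcd
      by_cases h3 : c = d
      · exact h3.le
      by_cases h4 : c = b
      · subst h4; exact absurd ((hB _ hrb).1 hcd) h
      exact (hlt_b c (lt_of_le_of_ne (hb' _ _ (hoff c h3 h4 _ hcd)) h4)).elim le_of_eq le_of_lt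
    by_cases h2 : d = b
    · subst h2
      rw [Equiv.swap_apply_right] at hcd
      by_cases h3 : c = a
      · exact h3.trans_le hlt.le
      by_cases h4 : c = d
      · exact h4.le
      exact (hb' _ _ (hoff c h3 h4 _ hcd)).trans hlt.le
    rw [Equiv.swap_apply_of_ne_of_ne h1 h2] at hcd
    have hle : (a ≤ d ↔ b ≤ d) := by
      rw [← not_lt, ← not_lt, (hoth d h1 h2).1]
    by_cases h3 : c = a
    · subst h3
      rcases hCa (π d) with ⟨-, h5, -⟩ | ⟨s, -, -, -, h5⟩
      · exact hle.2 (hb' _ _ (h5.1 hcd))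
      · exact hb' _ _ ((h5 _ le_rfl _).1 hcd)
    by_cases h4 : c = b
    · subst h4
      rcases hCa (π d) with ⟨-, -, h5⟩ | ⟨s, -, -, -, h5⟩
      · exact hle.1 (hb' _ _ (h5.1 hcd))
      · exact hb' _ _ ((h5 _ le_rfl _).1 hcd)
    exact hb' _ _ (hoff c h3 h4 _ hcd)
  · intro c y h1 d hdc h2 s hs h3
    rcases hCa y with ⟨h4, h5, h6⟩ | ⟨r, -, -, -, h4⟩
    swap
    · exact hc c y ((h4 y le_rfl c).1 h1) d hdc ((h4 y le_rfl d).1 h2) s hs ((h4 s hs.le c).1 h3)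
    by_cases hca : c = a
    · subst hca
      have hd' : (d, y) ∈ T := hoff d (hne d hdc).1 (hne d hdc).2 _ h2
      rcases hCa s with ⟨-, h7, -⟩ | ⟨r, h7, h8, -, -⟩
      · exact hc b y (h5.1 h1) d (hdc.trans hlt) hd' s hs (h7.1 h3)
      · exact hc b y (h5.1 h1) d (hdc.trans hlt) hd' r (h4 r h7 h8) h8
    by_cases hcb : c = b
    · subst hcb
      rcases hlt_b d hdc with rfl | hda
      · exact absurd (h4 y (h6.1 h1) (h5.1 h2)) (lt_irrefl _)
      have hd' : (d, y) ∈ T := hoff d (hne d hda).1 (hne d hda).2 _ h2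
      rcases hCa s with ⟨-, -, h7⟩ | ⟨r, h7, h8, -, -⟩
      · exact hc a y (h6.1 h1) d hda hd' s hs (h7.1 h3)
      · exact hc a y (h6.1 h1) d hda hd' r (h4 r h7 h8) h7
    have h1' := hoff c hca hcb y h1
    have h3' := hoff c hca hcb s h3
    by_cases hda : d = a
    · subst hda
      exact hc c y h1' b ((hoth c hca hcb).2.1 hdc) (h5.1 h2) s hs h3'
    by_cases hdb : d = b
    · subst hdb
      exact hc c y h1' a ((hoth c hca hcb).2.2 hdc) (h6.1 h2) s hs h3'
    exact hc c y h1' d hdc (hoff d hda hdb y h2) s hs h3'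
  · intro c y h1
    rcases hCa y with ⟨h4, h5, h6⟩ | ⟨r, -, -, -, h4⟩
    swap
    · refine (hd c y ((h4 y le_rfl c).1 h1)).imp_right (Or.imp ?_ ?_)
      · exact fun ⟨s, hs, h⟩ => ⟨s, hs, (h4 s hs.le c).2 h⟩
      · exact fun ⟨d, hd, h⟩ => ⟨d, hd, (h4 y le_rfl d).2 h⟩
    by_cases hca : c = a
    · subst hca
      rcases hd b y (h5.1 h1) with h7 | ⟨s, hs, h7⟩ | ⟨d, hdb, h7⟩
      · omega
      · refine Or.inr (Or.inl ?_)
        rcases hCa s with ⟨-, h8, -⟩ | ⟨r, h8, h9, -, -⟩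
        · exact ⟨s, hs, h8.2 h7⟩
        · exact ⟨r, h4 r h8 h9, (hK _ r r h8 h9 le_rfl).2 h8⟩
      · rcases hlt_b d hdb with rfl | hda
        · exact absurd (h4 y h7 (h5.1 h1)) (lt_irrefl _)
        · exact Or.inr (Or.inr ⟨d, hda, (hO d y (hne d hda).1 (hne d hda).2).2 h7⟩)
    by_cases hcb : c = b
    · subst hcb
      rcases hd a y (h6.1 h1) with ⟨h7, h8⟩ | ⟨s, hs, h7⟩ | ⟨d, hda, h7⟩
      · obtain ⟨r, h9, h10⟩ := hzero h7
        have := h4 r h9 h10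
        rw [Fin.lt_def] at this
        omega
      · refine Or.inr (Or.inl ?_)
        rcases hCa s with ⟨-, -, h8⟩ | ⟨r, h8, h9, -, -⟩
        · exact ⟨s, hs, h8.2 h7⟩
        · exact ⟨r, h4 r h8 h9, (hK _ r r h8 h9 le_rfl).2 h9⟩
      · exact Or.inr (Or.inr ⟨d, hda.trans hlt, (hO d y (hne d hda).1 (hne d hda).2).2 h7⟩)
    refine (hd c y (hoff c hca hcb y h1)).imp_right (Or.imp ?_ ?_)
    · exact fun ⟨s, hs, h⟩ => ⟨s, hs, (hO c s hca hcb).2 h⟩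
    · rintro ⟨d, hdc, hdy⟩
      by_cases hda : d = a
      · subst hda
        exact ⟨b, (hoth c hca hcb).2.1 hdc, h6.2 hdy⟩
      by_cases hdb : d = b
      · subst hdb
        exact ⟨a, (hoth c hca hcb).2.2 hdc, h5.2 hdy⟩
      exact ⟨d, hdc, (hO d y hda hdb).2 hdy⟩
  · rw [hA _ hra]
    exact fun h1 => absurd (hb' _ _ h1) (not_le.2 hlt)

theorem ncard_notMem_CNATs_mul_swap {n : ℕ} (π : Equiv.Perm (Fin n)) {a b : Fin n}
    (hab : (b : ℕ) = a + 1) :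
    {T ∈ CNATs π | (a, π b) ∉ T}.ncard = {T ∈ CNATs (π * Equiv.swap a b) | (a, π a) ∉ T}.ncard := by
  refine Set.ncard_congr (fun T _ => columnSwap a b T) ?_ ?_ ?_
  · exact fun T hT => columnSwap_mem_CNATs hab hT.1 hT.2
  · intro T T' _ _ h
    rw [← columnSwap_columnSwap a b T, ← columnSwap_columnSwap a b T']
    exact congrArg _ h
  · intro T hT
    refine ⟨columnSwap a b T, ?_, columnSwap_columnSwap a b T⟩
    have := columnSwap_mem_CNATs hab hT.1 (by
      rw [Equiv.Perm.mul_apply, Equiv.swap_apply_right]; exact hT.2)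
    rw [mul_assoc, Equiv.swap_mul_self, mul_one, Equiv.Perm.mul_apply, Equiv.swap_apply_left] at this
    exact this

theorem ncard_mem_add_ncard_notMem {n : ℕ} (π : Equiv.Perm (Fin n)) (p : Fin n × Fin n) :
    {T ∈ CNATs π | p ∈ T}.ncard + {T ∈ CNATs π | p ∉ T}.ncard = cnat π := by
  have h : CNATs π = {T ∈ CNATs π | p ∈ T} ∪ {T ∈ CNATs π | p ∉ T} := by
    ext T
    by_cases h : p ∈ T <;> simp [h]
  rw [cnat]
  conv_rhs => rw [h]
  rw [Set.ncard_union_eq]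
  exact Set.disjoint_left.2 fun T h1 h2 => h2.2 h1.2

/-- Transposing an adjacent ascent does not decrease the number of associated trees; the new
trees are those with a dot at the new inversion. -/
theorem cnat_mul_swap {n : ℕ} (π : Equiv.Perm (Fin n)) {a b : Fin n} (hab : (b : ℕ) = a + 1)
    (h : π a < π b) :
    cnat (π * Equiv.swap a b) = {T ∈ CNATs (π * Equiv.swap a b) | (a, π a) ∈ T}.ncard + cnat π := by
  rw [← ncard_mem_add_ncard_notMem (π * Equiv.swap a b) (a, π a),
    ← ncard_notMem_CNATs_mul_swap π hab, cnat]
  -- A dot at `(a, π b)` would lie below the leaf of column `a`.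
  congr 2
  ext T
  simp only [Set.mem_ofPred_eq, and_iff_left_iff_imp]
  intro hT h'
  exact absurd ((mem_CNATs_iff.1 hT).2.1 _ _ h') (not_le.2 h)

/-! ### Strict maximality of the decreasing permutation -/

theorem exists_ascent_of_ne_decPerm {m : ℕ} {π : Equiv.Perm (Fin (m + 1))}
    (h : π ≠ decPerm (m + 1)) : ∃ i : Fin m, π i.castSucc < π i.succ := by
  by_contra! hle
  have hanti : StrictAnti π := Fin.strictAnti_iff_succ_lt.2 fun i =>
    lt_of_le_of_ne (hle i) fun h => (Fin.castSucc_lt_succ (i := i)).ne (π.injective h.symm)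
  have hmono : StrictMono (fun i => π (Fin.rev i)) := fun i j hij => hanti (Fin.rev_lt_rev.2 hij)
  -- A finite chain has only the identity as order automorphism.
  have hid := Subsingleton.elim
    (hmono.orderIsoOfSurjective _ (π.surjective.comp Fin.rev_surjective)) (OrderIso.refl _)
  refine h (Equiv.ext fun i => ?_)
  have := DFunLike.congr_fun hid (Fin.rev i)
  simpa [decPerm] using this

theorem exists_mem_CNATs_decPerm {m : ℕ} (i : Fin m) :
    ∃ T ∈ CNATs (decPerm (m + 1)), (i.castSucc, decPerm (m + 1) i.succ) ∈ T := by
  have hi := i.2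
  -- Besides the leaves, the tree fills the top row up to column `i` and column `i` down to the
  -- required corner. Leaves left of column `i` hang from the top row, those right of it from column
  -- `i`.
  refine ⟨{p | p.2 = decPerm (m + 1) p.1 ∨ ((p.1 : ℕ) ≤ i ∧ (p.2 : ℕ) = 0) ∨
    ((p.1 : ℕ) = i ∧ (p.2 : ℕ) + i + 1 ≤ m)}, mem_CNATs_iff.2 ⟨?_, ?_, ?_, ?_, ?_⟩, ?_⟩
  · exact fun c => Or.inl rfl
  · intro c r h
    simp only [Set.mem_ofPred_eq, decPerm, Fin.revPerm_apply, Fin.ext_iff, Fin.val_rev,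
      Fin.le_def] at h ⊢
    omega
  · intro c r h
    simp only [Set.mem_ofPred_eq, decPerm, Fin.revPerm_apply, Fin.ext_iff, Fin.val_rev,
      Fin.le_def] at h ⊢
    omega
  · intro c r h1 d hd h2 s hs h3
    simp only [Set.mem_ofPred_eq, decPerm, Fin.revPerm_apply, Fin.ext_iff, Fin.val_rev,
      Fin.lt_def] at h1 h2 h3 hd hs
    omega
  · intro c r h1
    by_cases h0 : (c : ℕ) = 0 ∧ (r : ℕ) = 0
    · exact Or.inl h0
    refine Or.inr ?_
    have hc := c.2
    have hr := r.2
    simp only [Set.mem_ofPred_eq, decPerm, Fin.revPerm_apply, Fin.ext_iff, Fin.val_rev,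
      Fin.lt_def] at h1 ⊢
    by_cases h2 : (c : ℕ) ≤ i
    · by_cases h3 : (r : ℕ) = 0
      · exact Or.inr ⟨0, by rw [Fin.val_zero]; omega, by rw [Fin.val_zero]; omega⟩
      · exact Or.inl ⟨0, by rw [Fin.val_zero]; omega, by rw [Fin.val_zero]; omega⟩
    · exact Or.inr ⟨i.castSucc, by rw [Fin.val_castSucc]; omega, by rw [Fin.val_castSucc]; omega⟩
  · refine Or.inr (Or.inr ⟨rfl, ?_⟩)
    change ((Fin.rev i.succ : Fin (m + 1)) : ℕ) + i + 1 ≤ m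
    rw [Fin.val_rev, Fin.val_succ]
    omega

theorem cnat_lt_cnat_decPerm {m : ℕ} {π : Equiv.Perm (Fin (m + 1))} (h : π ≠ decPerm (m + 1)) :
    cnat π < cnat (decPerm (m + 1)) := by
  -- By rearrangement, this sum drops when an ascent is turned into a descent.
  induction hN : ∑ j : Fin (m + 1), (j : ℕ) * π j using Nat.strong_induction_on generalizing π with
  | _ N ih =>
  obtain ⟨i, hi⟩ := exists_ascent_of_ne_decPerm h
  have hab : ((i.succ : Fin (m + 1)) : ℕ) = (i.castSucc : Fin (m + 1)) + 1 := by simp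
  have hstep := cnat_mul_swap π hab hi
  by_cases hdec : π * Equiv.swap i.castSucc i.succ = decPerm (m + 1)
  · rw [hdec] at hstep
    obtain ⟨T, hT, hmem⟩ := exists_mem_CNATs_decPerm i
    rw [← hdec, Equiv.Perm.mul_apply, Equiv.swap_apply_right] at hmem
    have : 0 < {T ∈ CNATs (decPerm (m + 1)) | (i.castSucc, π i.castSucc) ∈ T}.ncard :=
      (Set.ncard_pos).2 ⟨T, hT, hmem⟩
    omega
  · refine lt_of_le_of_lt (by omega) (ih _ ?_ hdec rfl)
    rw [← hN]
    have hne : i.castSucc ≠ i.succ := (Fin.castSucc_lt_succ (i := i)).ne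
    rw [← Finset.add_sum_erase _ _ (Finset.mem_univ i.castSucc),
      ← Finset.add_sum_erase _ _ (Finset.mem_erase.2 ⟨hne.symm, Finset.mem_univ i.succ⟩),
      ← Finset.add_sum_erase _ _ (Finset.mem_univ i.castSucc),
      ← Finset.add_sum_erase _ _ (Finset.mem_erase.2 ⟨hne.symm, Finset.mem_univ i.succ⟩)]
    have hrest : ∑ j ∈ (Finset.univ.erase i.castSucc).erase i.succ,
          (j : ℕ) * (π * Equiv.swap i.castSucc i.succ) j =
        ∑ j ∈ (Finset.univ.erase i.castSucc).erase i.succ, (j : ℕ) * π j := by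
      refine Finset.sum_congr rfl fun j hj => ?_
      simp only [Finset.mem_erase] at hj
      rw [Equiv.Perm.mul_apply, Equiv.swap_apply_of_ne_of_ne hj.2.1 hj.1]
    rw [hrest, Equiv.Perm.mul_apply, Equiv.Perm.mul_apply, Equiv.swap_apply_left,
      Equiv.swap_apply_right, hab, Fin.val_castSucc]
    rw [Fin.lt_def] at hi
    nlinarith

/-! ### Sliding the largest value and contracting leaves -/

/-- The permutation with the largest value at position `a` and the values of `σ` elsewhere. -/
def insertLast {m : ℕ} (σ : Equiv.Perm (Fin m)) (a : Fin (m + 1)) : Equiv.Perm (Fin (m + 1)) :=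
  ((finSuccEquiv' a).trans (Equiv.optionCongr σ)).trans (finSuccEquiv' (Fin.last m)).symm

@[simp]
theorem insertLast_self {m : ℕ} (σ : Equiv.Perm (Fin m)) (a : Fin (m + 1)) :
    insertLast σ a a = Fin.last m := by
  simp [insertLast]

@[simp]
theorem insertLast_succAbove {m : ℕ} (σ : Equiv.Perm (Fin m)) (a : Fin (m + 1)) (j : Fin m) :
    insertLast σ a (a.succAbove j) = (σ j).castSucc := by
  simp [insertLast]

theorem insertLast_succ {m : ℕ} (σ : Equiv.Perm (Fin m)) (k : Fin m) :
    insertLast σ k.castSucc k.succ = (σ k).castSucc := by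
  rw [← insertLast_succAbove σ k.castSucc k, Fin.succAbove_castSucc_self]

theorem succAbove_succ_eq {m : ℕ} {k j : Fin m} (h : j ≠ k) :
    k.succ.succAbove j = k.castSucc.succAbove j := by
  rcases lt_or_gt_of_ne h with h | h
  · rw [Fin.succAbove_of_castSucc_lt, Fin.succAbove_of_castSucc_lt]
    · exact Fin.castSucc_lt_castSucc_iff.2 h
    · exact (Fin.castSucc_lt_castSucc_iff.2 h).trans Fin.castSucc_lt_succ
  · rw [Fin.succAbove_of_le_castSucc, Fin.succAbove_of_le_castSucc]
    · exact Fin.castSucc_le_castSucc_iff.2 h.le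
    · exact Fin.succ_le_castSucc_iff.2 h

theorem insertLast_castSucc_mul_swap {m : ℕ} (σ : Equiv.Perm (Fin m)) (k : Fin m) :
    insertLast σ k.castSucc * Equiv.swap k.castSucc k.succ = insertLast σ k.succ := by
  ext1 c
  rw [Equiv.Perm.mul_apply]
  rcases Fin.eq_self_or_eq_succAbove k.succ c with rfl | ⟨j, rfl⟩
  · rw [Equiv.swap_apply_right, insertLast_self, insertLast_self]
  · rw [insertLast_succAbove]
    by_cases h : j = k
    · subst h
      rw [Fin.succAbove_succ_self, Equiv.swap_apply_left, insertLast_succ]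
    · rw [Equiv.swap_apply_of_ne_of_ne, succAbove_succ_eq h, insertLast_succAbove]
      · rw [succAbove_succ_eq h]
        exact Fin.succAbove_ne _ _
      · exact Fin.succAbove_ne _ _

theorem decPerm_succ (m : ℕ) : decPerm (m + 1) = insertLast (decPerm m) 0 := by
  ext1 c
  rcases Fin.eq_self_or_eq_succAbove 0 c with rfl | ⟨j, rfl⟩
  · simp [decPerm]
  · rw [insertLast_succAbove]
    simp [decPerm, Fin.rev_succ]

/-- A binary tree with at least two leaves has no leaf in the bottom right corner. -/
theorem cnat_eq_zero_of_last {m : ℕ} (hm : 1 ≤ m) {π : Equiv.Perm (Fin (m + 1))}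
    (h : π (Fin.last m) = Fin.last m) : cnat π = 0 := by
  rw [cnat, Set.ncard_eq_zero, Set.eq_empty_iff_forall_notMem]
  intro T hT
  obtain ⟨ha, hb, hb', -, hd⟩ := mem_CNATs_iff.1 hT
  have hL := ha (Fin.last m)
  rw [h] at hL
  rcases hd _ _ hL with ⟨h1, -⟩ | ⟨s, hs, h1⟩ | ⟨d, hd, h1⟩
  · rw [Fin.val_last] at h1
    omega
  -- A dot in the last column can only be in a row whose leaf is in that column, which is the last
  -- row.
  · have := hb' (Fin.last m) (π.symm s) (by simpa using h1)
    rw [Fin.last_le_iff, Equiv.symm_apply_eq, h] at this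
    exact hs.ne this
  · have := hb _ _ h1
    rw [Fin.last_le_iff, ← h, π.injective.eq_iff] at this
    exact hd.ne this

/-- The tree obtained by contracting the two leaves adjacent to a dot: column `k + 1` and the last
row are removed. -/
def contract {m : ℕ} (k : Fin m) (T : Set (Fin (m + 1) × Fin (m + 1))) : Set (Fin m × Fin m) :=
  {p | (k.succ.succAbove p.1, p.2.castSucc) ∈ T}

theorem succAbove_succ_le_iff {m : ℕ} {k c : Fin m} : k.succ.succAbove c ≤ k.succ ↔ c ≤ k := by
  rw [(Fin.succAbove_ne k.succ c).le_iff_lt, Fin.succAbove_lt_iff_castSucc_lt,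
    Fin.castSucc_lt_succ_iff]

/-- The leaf of column `k + 1` already has the corner dot to its left, so nothing may lie above it.
-/
theorem mem_succ_iff_of_mem_CNATs {m : ℕ} {σ : Equiv.Perm (Fin m)} {k : Fin m}
    {T : Set (Fin (m + 1) × Fin (m + 1))} (hT : T ∈ CNATs (insertLast σ k.castSucc))
    (hk : (k.castSucc, (σ k).castSucc) ∈ T) {y : Fin (m + 1)} :
    (k.succ, y) ∈ T ↔ y = (σ k).castSucc := by
  obtain ⟨ha, hb, hb', hc, -⟩ := mem_CNATs_iff.1 hT
  have h1 := ha k.succ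
  rw [insertLast_succ] at h1
  constructor
  · intro hy
    have h2 := hb _ _ hy
    rw [insertLast_succ] at h2
    by_contra hne
    exact hc _ _ h1 _ Fin.castSucc_lt_succ hk y (lt_of_le_of_ne h2 hne) hy
  · rintro rfl
    exact h1

theorem mem_last_iff_of_mem_CNATs {m : ℕ} {σ : Equiv.Perm (Fin m)} {k : Fin m}
    {T : Set (Fin (m + 1) × Fin (m + 1))} (hT : T ∈ CNATs (insertLast σ k.castSucc))
    {c : Fin (m + 1)} : (c, Fin.last m) ∈ T ↔ c = k.castSucc := by
  obtain ⟨ha, hb, -, -, -⟩ := mem_CNATs_iff.1 hT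
  constructor
  · intro h
    have := hb _ _ h
    rw [Fin.last_le_iff, ← insertLast_self σ k.castSucc, (insertLast σ _).injective.eq_iff] at this
    exact this
  · rintro rfl
    have := ha k.castSucc
    rwa [insertLast_self] at this

/-- The corner becomes the leaf of column `k`, so no other dot of that column may remain below it;
`hσ` ensures this. -/
theorem contract_mem_CNATs {m : ℕ} {σ : Equiv.Perm (Fin m)} {k : Fin m}
    (hσ : ∀ j, k < j → σ j < σ k) {T : Set (Fin (m + 1) × Fin (m + 1))}
    (hT : T ∈ CNATs (insertLast σ k.castSucc)) (hk : (k.castSucc, (σ k).castSucc) ∈ T) :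
    contract k T ∈ CNATs σ := by
  obtain ⟨ha, hb, hb', hc, hd⟩ := mem_CNATs_iff.1 hT
  have hval : ∀ j, j ≠ k → insertLast σ k.castSucc (k.succ.succAbove j) = (σ j).castSucc :=
    fun j hj => by rw [succAbove_succ_eq hj, insertLast_succAbove]
  refine mem_CNATs_iff.2 ⟨?_, ?_, ?_, ?_, ?_⟩
  · intro c
    by_cases h : c = k
    · subst h
      simpa [contract] using hk
    · have := ha (k.succ.succAbove c)
      rwa [hval c h] at this
  · intro c r h
    change (_, _) ∈ T at h
    by_cases hck : c = k
    · subst hck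
      rw [Fin.succAbove_succ_self] at h
      -- The leaf of row `σ j` cannot be left of column `k`; if it is to the right, `hσ` puts the
      -- row above `σ k`.
      obtain ⟨j, rfl⟩ := σ.surjective r
      rcases lt_trichotomy j c with hj | rfl | hj
      · rw [← hval j hj.ne] at h
        have := hb' _ _ h
        rw [← Fin.succAbove_succ_self, Fin.succAbove_le_succAbove_iff] at this
        exact absurd hj (not_lt.2 this)
      · exact le_rfl
      · exact (hσ j hj).le
    · have := hb _ _ h
      rw [hval c hck] at this
      exact Fin.castSucc_le_castSucc_iff.1 this
  · intro c d h
    change (_, _) ∈ T at h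
    by_cases hdk : d = k
    · subst hdk
      rw [← insertLast_succ] at h
      exact succAbove_succ_le_iff.1 (hb' _ _ h)
    · rw [← hval d hdk] at h
      exact Fin.succAbove_le_succAbove_iff.1 (hb' _ _ h)
  · intro c r h1 d hdc h2 s hs h3
    exact hc _ _ h1 _ (Fin.succAbove_lt_succAbove_iff.2 hdc) h2 _
      (Fin.castSucc_lt_castSucc_iff.2 hs) h3
  · intro c r h
    change (_, _) ∈ T at h
    rcases hd _ _ h with ⟨h1, h2⟩ | ⟨s, hs, h1⟩ | ⟨d, hdc, h1⟩
    · refine Or.inl ⟨?_, h2⟩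
      rcases Fin.castSucc_lt_or_lt_succ k.succ c with h3 | h3
      · rwa [Fin.succAbove_of_castSucc_lt _ _ h3] at h1
      · rw [Fin.succAbove_of_lt_succ _ _ h3, Fin.val_succ] at h1
        omega
    · refine Or.inr (Or.inl ?_)
      obtain ⟨s, rfl⟩ := Fin.exists_castSucc_eq.2 (hs.trans_le (Fin.le_last _)).ne
      exact ⟨s, Fin.castSucc_lt_castSucc_iff.1 hs, h1⟩
    · refine Or.inr (Or.inr ?_)
      rcases Fin.eq_self_or_eq_succAbove k.succ d with rfl | ⟨d, rfl⟩
      -- The only dot of the deleted column is a leaf, so it is nobody's left parent.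
      · rw [(mem_succ_iff_of_mem_CNATs hT hk).1 h1, ← insertLast_succ] at h
        exact absurd hdc (not_lt.2 (hb' _ _ h))
      · exact ⟨d, Fin.succAbove_lt_succAbove_iff.1 hdc, h1⟩

/-- The tree obtained by turning the leaf in column `k` into a dot with two adjacent leaves. -/
def expand {m : ℕ} (σ : Equiv.Perm (Fin m)) (k : Fin m) (S : Set (Fin m × Fin m)) :
    Set (Fin (m + 1) × Fin (m + 1)) :=
  {p | (∃ c r, p = (k.succ.succAbove c, Fin.castSucc r) ∧ (c, r) ∈ S) ∨
    p = (k.succ, (σ k).castSucc) ∨ p = (k.castSucc, Fin.last m)}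

theorem mem_expand {m : ℕ} {σ : Equiv.Perm (Fin m)} {k : Fin m} {S : Set (Fin m × Fin m)}
    {c r : Fin m} : (k.succ.succAbove c, Fin.castSucc r) ∈ expand σ k S ↔ (c, r) ∈ S := by
  constructor
  · rintro (⟨c', r', h, h'⟩ | h | h)
    · rw [Prod.mk.injEq, Fin.succAbove_right_inj, Fin.castSucc_inj] at h
      rwa [h.1, h.2]
    · exact absurd (congrArg Prod.fst h) (Fin.succAbove_ne _ _)
    · exact absurd (congrArg Prod.snd h) (Fin.castSucc_lt_last r).ne
  · exact fun h => Or.inl ⟨c, r, rfl, h⟩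

theorem succ_mem_expand {m : ℕ} {σ : Equiv.Perm (Fin m)} {k : Fin m} {S : Set (Fin m × Fin m)}
    {y : Fin (m + 1)} : (k.succ, y) ∈ expand σ k S ↔ y = (σ k).castSucc := by
  constructor
  · rintro (⟨c', r', h, h'⟩ | h | h)
    · exact absurd (congrArg Prod.fst h) (Fin.succAbove_ne _ _).symm
    · exact congrArg Prod.snd h
    · exact absurd (congrArg Prod.fst h) Fin.castSucc_lt_succ.ne'
  · rintro rfl
    exact Or.inr (Or.inl rfl)

theorem last_mem_expand {m : ℕ} {σ : Equiv.Perm (Fin m)} {k : Fin m} {S : Set (Fin m × Fin m)}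
    {c : Fin (m + 1)} : (c, Fin.last m) ∈ expand σ k S ↔ c = k.castSucc := by
  constructor
  · rintro (⟨c', r', h, h'⟩ | h | h)
    · exact absurd (congrArg Prod.snd h) (Fin.castSucc_lt_last r').ne'
    · exact absurd (congrArg Prod.snd h) (Fin.castSucc_lt_last _).ne'
    · exact congrArg Prod.fst h
  · rintro rfl
    exact Or.inr (Or.inr rfl)

theorem contract_expand {m : ℕ} (σ : Equiv.Perm (Fin m)) (k : Fin m) (S : Set (Fin m × Fin m)) :
    contract k (expand σ k S) = S := by
  ext ⟨c, r⟩
  exact mem_expand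

theorem expand_contract {m : ℕ} {σ : Equiv.Perm (Fin m)} {k : Fin m}
    {T : Set (Fin (m + 1) × Fin (m + 1))} (hT : T ∈ CNATs (insertLast σ k.castSucc))
    (hk : (k.castSucc, (σ k).castSucc) ∈ T) : expand σ k (contract k T) = T := by
  ext ⟨c, r⟩
  rcases Fin.eq_self_or_eq_succAbove k.succ c with rfl | ⟨c, rfl⟩
  · rw [succ_mem_expand, mem_succ_iff_of_mem_CNATs hT hk]
  rcases Fin.eq_castSucc_or_eq_last r with ⟨r, rfl⟩ | rfl
  · exact mem_expand
  · rw [last_mem_expand, mem_last_iff_of_mem_CNATs hT]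

theorem expand_mem_CNATs {m : ℕ} {σ : Equiv.Perm (Fin m)} {k : Fin m} {S : Set (Fin m × Fin m)}
    (hS : S ∈ CNATs σ) : expand σ k S ∈ CNATs (insertLast σ k.castSucc) ∧
      (k.castSucc, (σ k).castSucc) ∈ expand σ k S := by
  obtain ⟨ha, hb, hb', hc, hd⟩ := mem_CNATs_iff.1 hS
  have hval : ∀ j, j ≠ k → insertLast σ k.castSucc (k.succ.succAbove j) = (σ j).castSucc :=
    fun j hj => by rw [succAbove_succ_eq hj, insertLast_succAbove]
  have hmem : (k.castSucc, (σ k).castSucc) ∈ expand σ k S := by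
    rw [← Fin.succAbove_succ_self, mem_expand]
    exact ha k
  refine ⟨mem_CNATs_iff.2 ⟨?_, ?_, ?_, ?_, ?_⟩, hmem⟩
  · intro c
    rcases Fin.eq_self_or_eq_succAbove k.succ c with rfl | ⟨c, rfl⟩
    · rw [succ_mem_expand, insertLast_succ]
    by_cases h : c = k
    · subst h
      rw [Fin.succAbove_succ_self, insertLast_self, last_mem_expand]
    · rw [hval c h, mem_expand]
      exact ha c
  · intro c r h
    rcases Fin.eq_self_or_eq_succAbove k.succ c with rfl | ⟨c, rfl⟩
    · rw [succ_mem_expand] at h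
      rw [h, insertLast_succ]
    by_cases hck : c = k
    · subst hck
      rw [Fin.succAbove_succ_self, insertLast_self]
      exact Fin.le_last r
    rcases Fin.eq_castSucc_or_eq_last r with ⟨r, rfl⟩ | rfl
    · rw [mem_expand] at h
      rw [hval c hck]
      exact Fin.castSucc_le_castSucc_iff.2 (hb _ _ h)
    · rw [last_mem_expand, ← Fin.succAbove_succ_self, Fin.succAbove_right_inj] at h
      exact absurd h hck
  · intro c d h
    rcases Fin.eq_self_or_eq_succAbove k.succ d with rfl | ⟨d, rfl⟩
    · rcases Fin.eq_self_or_eq_succAbove k.succ c with rfl | ⟨c, rfl⟩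
      · exact le_rfl
      rw [insertLast_succ, mem_expand] at h
      exact succAbove_succ_le_iff.2 (hb' _ _ h)
    by_cases hdk : d = k
    · subst hdk
      rw [Fin.succAbove_succ_self, insertLast_self, last_mem_expand] at h
      rw [h, Fin.succAbove_succ_self]
    rw [hval d hdk] at h
    rcases Fin.eq_self_or_eq_succAbove k.succ c with rfl | ⟨c, rfl⟩
    · rw [succ_mem_expand, Fin.castSucc_inj, σ.injective.eq_iff] at h
      exact absurd h hdk
    · rw [mem_expand] at h
      exact Fin.succAbove_le_succAbove_iff.2 (hb' _ _ h)
  · intro c r h1 d hdc h2 s hs h3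
    rcases Fin.eq_self_or_eq_succAbove k.succ c with rfl | ⟨c, rfl⟩
    · rw [succ_mem_expand] at h1 h3
      exact hs.ne (h3.trans h1.symm)
    rcases Fin.eq_castSucc_or_eq_last r with ⟨r, rfl⟩ | rfl
    swap
    · rw [last_mem_expand] at h1 h2
      exact hdc.ne (h2.trans h1.symm)
    obtain ⟨s, rfl⟩ := Fin.exists_castSucc_eq.2 (hs.trans_le (Fin.le_last _)).ne
    rw [mem_expand] at h1 h3
    rcases Fin.eq_self_or_eq_succAbove k.succ d with rfl | ⟨d, rfl⟩
    · rw [succ_mem_expand, Fin.castSucc_inj] at h2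
      rw [h2] at h1
      exact absurd (succAbove_succ_le_iff.2 (hb' _ _ h1)) (not_le.2 hdc)
    · rw [mem_expand] at h2
      exact hc _ _ h1 d (Fin.succAbove_lt_succAbove_iff.1 hdc) h2 s
        (Fin.castSucc_lt_castSucc_iff.1 hs) h3
  · intro c r h
    rcases Fin.eq_self_or_eq_succAbove k.succ c with rfl | ⟨c, rfl⟩
    · rw [succ_mem_expand] at h
      exact Or.inr (Or.inr ⟨k.castSucc, Fin.castSucc_lt_succ, h ▸ hmem⟩)
    rcases Fin.eq_castSucc_or_eq_last r with ⟨r, rfl⟩ | rfl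
    swap
    · rw [last_mem_expand] at h
      exact Or.inr (Or.inl ⟨(σ k).castSucc, Fin.castSucc_lt_last _, h ▸ hmem⟩)
    rw [mem_expand] at h
    rcases hd _ _ h with ⟨h1, h2⟩ | ⟨s, hs, h1⟩ | ⟨d, hdc, h1⟩
    · refine Or.inl ⟨?_, h2⟩
      rw [Fin.succAbove_of_castSucc_lt, Fin.val_castSucc, h1]
      rw [Fin.lt_def, Fin.val_castSucc, h1, Fin.val_succ]
      omega
    · exact Or.inr (Or.inl ⟨s.castSucc, Fin.castSucc_lt_castSucc_iff.2 hs, mem_expand.2 h1⟩)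
    · exact Or.inr (Or.inr ⟨k.succ.succAbove d, Fin.succAbove_lt_succAbove_iff.2 hdc,
        mem_expand.2 h1⟩)

theorem ncard_mem_CNATs_insertLast {m : ℕ} {σ : Equiv.Perm (Fin m)} {k : Fin m}
    (hσ : ∀ j, k < j → σ j < σ k) :
    {T ∈ CNATs (insertLast σ k.castSucc) | (k.castSucc, (σ k).castSucc) ∈ T}.ncard = cnat σ := by
  refine Set.ncard_congr (fun T _ => contract k T) ?_ ?_ ?_
  · exact fun T hT => contract_mem_CNATs hσ hT.1 hT.2
  · intro T T' hT hT' h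
    rw [← expand_contract hT.1 hT.2, ← expand_contract hT'.1 hT'.2]
    exact congrArg _ h
  · exact fun S hS => ⟨expand σ k S, expand_mem_CNATs hS, contract_expand σ k S⟩

/-- Sliding the largest value one place left creates one inversion, and the trees with a dot at its
corner contract to the trees for `σ`. -/
theorem cnat_insertLast_castSucc {m : ℕ} {σ : Equiv.Perm (Fin m)} {k : Fin m}
    (hσ : ∀ j, k < j → σ j < σ k) :
    cnat (insertLast σ k.castSucc) = cnat σ + cnat (insertLast σ k.succ) := by
  have hs : insertLast σ k.succ * Equiv.swap k.castSucc k.succ = insertLast σ k.castSucc := by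
    rw [← insertLast_castSucc_mul_swap, mul_assoc, Equiv.swap_mul_self, mul_one]
  have hk : insertLast σ k.succ k.castSucc = (σ k).castSucc := by
    rw [← insertLast_succAbove σ k.succ, Fin.succAbove_succ_self]
  have h := cnat_mul_swap (insertLast σ k.succ) (a := k.castSucc) (b := k.succ) (by simp)
    (by rw [hk, insertLast_self]; exact Fin.castSucc_lt_last _)
  rw [hs, hk, ncard_mem_CNATs_insertLast hσ] at h
  exact h

/-! ### The count for the decreasing permutation -/

theorem cnat_insertLast_decPerm {m : ℕ} (hm : 1 ≤ m) (a : Fin (m + 1)) :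
    cnat (insertLast (decPerm m) a) = (m - a) * cnat (decPerm m) := by
  induction a using Fin.reverseInduction with
  | last => rw [cnat_eq_zero_of_last hm (insertLast_self _ _), Fin.val_last, Nat.sub_self, zero_mul]
  | cast k ih =>
    rw [cnat_insertLast_castSucc fun j hj => Fin.rev_lt_rev.2 hj, ih, Fin.val_succ,
      Fin.val_castSucc, add_comm, ← Nat.succ_mul]
    congr 1
    omega

theorem cnat_perm_fin_one (π : Equiv.Perm (Fin 1)) : cnat π = 1 := by
  rw [cnat, Set.ncard_eq_one]
  refine ⟨Set.univ, Set.eq_singleton_iff_unique_mem.2 ⟨mem_CNATs_iff.2 ?_, fun T hT => ?_⟩⟩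
  · refine ⟨fun c => trivial, fun c r _ => (Subsingleton.elim _ _).le,
      fun c r _ => (Subsingleton.elim _ _).le, fun c r _ d hd => ?_, fun c r _ => ?_⟩
    · exact absurd (Subsingleton.elim d c) hd.ne
    · exact Or.inl ⟨by omega, by omega⟩
  · refine Set.eq_univ_of_forall fun p => ?_
    have := (mem_CNATs_iff.1 hT).1 p.1
    rwa [Subsingleton.elim (π p.1) p.2] at this

theorem cnat_decPerm (m : ℕ) : cnat (decPerm (m + 1)) = m ! := by
  induction m with
  | zero => exact cnat_perm_fin_one _
  | succ m ih =>
    rw [decPerm_succ, cnat_insertLast_decPerm (Nat.le_add_left 1 m), ih, Fin.val_zero, Nat.sub_zero,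
      Nat.factorial_succ]

theorem mainTheorem4 (n : ℕ) (hn : 1 ≤ n) :
    IsGreatest (Set.range (fun π : Equiv.Perm (Fin n) => cnat π)) ((n - 1)!) ∧
    (∀ π : Equiv.Perm (Fin n), cnat π = (n - 1)! ↔ π = decPerm n) ∧
    permsWithCNATs n ((n - 1)!) = {decPerm n} ∧
    (∀ k : ℕ, (n - 1)! < k → permsWithCNATs n k = ∅) := by
  obtain ⟨m, rfl⟩ : ∃ m, n = m + 1 := ⟨n - 1, by omega⟩
  rw [Nat.add_sub_cancel]
  have hle : ∀ π : Equiv.Perm (Fin (m + 1)), cnat π ≤ m ! := fun π => by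
    rw [← cnat_decPerm]
    by_cases h : π = decPerm (m + 1)
    · rw [h]
    · exact (cnat_lt_cnat_decPerm h).le
  have hiff : ∀ π : Equiv.Perm (Fin (m + 1)), cnat π = m ! ↔ π = decPerm (m + 1) := fun π => by
    refine ⟨fun h => ?_, fun h => h ▸ cnat_decPerm m⟩
    by_contra hne
    exact (cnat_lt_cnat_decPerm hne).ne (h.trans (cnat_decPerm m).symm)
  refine ⟨⟨⟨decPerm (m + 1), cnat_decPerm m⟩, ?_⟩, hiff, Set.ext hiff, fun k hk => ?_⟩
  · rintro _ ⟨π, rfl⟩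
    exact hle π
  · exact Set.eq_empty_of_forall_notMem fun π hπ => absurd (hle π) (not_le.2 (hk.trans_eq hπ.symm))
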